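/- Let $A\in\mathbb{C}^{n\times n}$ be Hermitian, and let $X,Y\in\mathbb{C}^{n\times k}$ have orthonormal columns, spanning the $k$-dimensional subspaces $\mathcal{X},\mathcal{Y}\subseteq\mathbb{C}^n$ respectively. Assume that $\mathcal{X}$ or $\mathcal{Y}$ is $A$-invariant. For a Hermitian matrix $M$ let $\lambda(M)$ be the vector of its eigenvalues, with multiplicity, in descending order; let $\mathrm{spr}(A)=\lambda_1(A)-\lambda_n(A)$; and let $\theta(\mathcal{X},\mathcal{Y})=(\theta_1,\dots,\theta_k)\in[0,\pi/2]^k$, in descending order, be the vector of principal angles between $\mathcal{X}$ and $\mathcal{Y}$, i.e. $\cos\theta_1\le\dots\le\cos\theta_k$ are the singular values of $X^HY$ in ascending order. Then $$|\lambda(X^HAX)-\lambda(Y^HAY)|\ \prec_w\ \mathrm{spr}(A)\,\tan^2\theta(\mathcal{X},\mathcal{Y}),$$ where absolute value and $\tan^2$ act componentwise, $\tan^2(\pi/2)=+\infty$ and $0\cdot\infty=0$, and $x\prec_w y$ (weak submajorization) means that for every $j=1,\dots,k$ the sum of the $j$ largest entries of $x$ is at most the sum of the $j$ largest entries of $y$.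 -/

import Mathlib

open scoped ENNReal Matrix

noncomputable section

namespace RitzMajorization

/-- The entries of `x`, with repetitions, rearranged in descending order. -/
def descending {α : Type*} [LinearOrder α] {k : ℕ} (x : Fin k → α) : Fin k → α :=
  fun i => x (Tuple.sort x (Fin.rev i))

theorem descending_antitone {α : Type*} [LinearOrder α] {k : ℕ} (x : Fin k → α) :
    Antitone (descending x) :=
  fun _ _ h => Tuple.monotone_sort x (Fin.rev_le_rev.mpr h)

/-- Weak (sub-)majorization: for every `j` the sum of the `j` largest entries of `x` is at most the
sum of the `j` largest entries of `y`. (The entries may be real, or in `[0, ∞]`.) -/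
def WeaklySubmajorizedBy {α : Type*} [LinearOrder α] [AddCommMonoid α] {k : ℕ}
    (x y : Fin k → α) : Prop :=
  ∀ j : Fin k, ∑ i ∈ Finset.Iic j, descending x i ≤ ∑ i ∈ Finset.Iic j, descending y i

/-- The vector of eigenvalues, with multiplicity, of a Hermitian matrix, in descending order. -/
def eigenvaluesDesc {m : ℕ} {A : Matrix (Fin m) (Fin m) ℂ} (hA : A.IsHermitian) : Fin m → ℝ :=
  fun i => hA.eigenvalues₀ (Fin.cast (Fintype.card_fin m).symm i)

theorem eigenvaluesDesc_antitone {m : ℕ} {A : Matrix (Fin m) (Fin m) ℂ} (hA : A.IsHermitian) :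
    Antitone (eigenvaluesDesc hA) :=
  fun _ _ h => hA.eigenvalues₀_antitone h

/-- The spread of a Hermitian matrix: largest minus smallest eigenvalue (`0` for the empty
matrix). -/
def spread {n : ℕ} {A : Matrix (Fin n) (Fin n) ℂ} (hA : A.IsHermitian) : ℝ :=
  if hn : 0 < n then
    eigenvaluesDesc hA ⟨0, hn⟩ - eigenvaluesDesc hA ⟨n - 1, Nat.sub_lt hn one_pos⟩
  else 0

theorem spread_nonneg {n : ℕ} {A : Matrix (Fin n) (Fin n) ℂ} (hA : A.IsHermitian) :
    0 ≤ spread hA := by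
  unfold spread
  split_ifs with hn
  · exact sub_nonneg.mpr (eigenvaluesDesc_antitone hA (Fin.mk_le_mk.mpr (Nat.zero_le _)))
  · exact le_rfl

/-- The vector of singular values of a `k × k` matrix (with respect to the Euclidean norm), with
multiplicity, in descending order. -/
def singularValuesDesc {k : ℕ} (B : Matrix (Fin k) (Fin k) ℂ) : Fin k → ℝ :=
  fun i => (Matrix.toEuclideanLin B).singularValues i

/-- For `X`, `Y` with orthonormal columns, the vector of principal angles between the column spaces
of `X` and `Y`, in descending order: `cos θ` is the vector of singular values of `Xᴴ Y` in
*ascending* order. -/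
def principalAngles {n k : ℕ} (X Y : Matrix (Fin n) (Fin k) ℂ) : Fin k → ℝ :=
  fun i => Real.arccos (singularValuesDesc (Xᴴ * Y) (Fin.rev i))

/-- `tan² θ = sin² θ / cos² θ` as an element of `[0, ∞]`; its value at `θ = π / 2` is `∞`. -/
def tanSq (θ : ℝ) : ℝ≥0∞ :=
  ENNReal.ofReal (Real.sin θ ^ 2) / ENNReal.ofReal (Real.cos θ ^ 2)

theorem tanSq_of_cos_ne_zero {θ : ℝ} (h : Real.cos θ ≠ 0) :
    tanSq θ = ENNReal.ofReal (Real.tan θ ^ 2) := by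
  rw [tanSq, Real.tan_eq_sin_div_cos, div_pow, ENNReal.ofReal_div_of_pos (by positivity)]

theorem tanSq_pi_div_two : tanSq (Real.pi / 2) = ∞ := by
  simp [tanSq]

end RitzMajorization

end

/-! The stronger bound with `2 * (1 - cos θ)` in place of `tan² θ` is what gets proved. Weak
majorization is tested by soft thresholds, comparing `∑ max (d i - t) 0` with `∑ max (β i - t) 0`
for all `t ≥ 0`: taking `t = β j` recovers the partial sums (`sum_descending_le`).

By symmetry the range of `X` is invariant. Write `A = m + r K` with `r = spr(A) / 2` and `K` a
symmetric contraction. A unitary change of basis, which preserves Ritz values, makes `Xᴴ Y` a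
diagonal operator `C` with entries `σ i = cos θ`. Then `Y u = X (C u) + z` with `z` orthogonal to
the range of `X`, and invariance removes the cross terms from the form of `K` at `Y u`. What remains
is bounded by a sum with coefficients `1 - σ i` (`abs_re_inner_compression_sub_le`).

`sum_abs_eigenvalues_sub_sub_max_le` (Lidskii) passes from differences of eigenvalues to eigenvalues
of the difference. In its eigenbasis, the bound on forms is an average with doubly substochastic
weights, which soft thresholds respect (`sum_max_sub_le_of_weights`). -/

namespace RitzMajorization

open Module

/-! ### Operators diagonal in an orthonormal basis -/

section Diagonal

variable {F ι : Type*} [NormedAddCommGroup F] [InnerProductSpace ℂ F] [Fintype ι]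

theorem inner_mul_symm_eq (x y : F) :
    (inner ℂ x y : ℂ) * inner ℂ y x = ((‖(inner ℂ y x : ℂ)‖ ^ 2 : ℝ) : ℂ) := by
  rw [← inner_conj_symm x y, Complex.conj_mul']
  push_cast; rfl

/-- The operator that is diagonal in the orthonormal basis `b`, with real diagonal entries `g`. -/
noncomputable def diagonalOperator (b : OrthonormalBasis ι ℂ F)
    (g : ι → ℝ) : F →ₗ[ℂ] F :=
  ∑ a, (g a : ℂ) • (innerₛₗ ℂ (b a)).smulRight (b a)

variable (b : OrthonormalBasis ι ℂ F) (g : ι → ℝ)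

theorem diagonalOperator_apply (x : F) :
    diagonalOperator b g x = ∑ a, (g a : ℂ) • inner ℂ (b a) x • b a := by
  simp [diagonalOperator, LinearMap.sum_apply]

theorem inner_diagonalOperator_left (x y : F) :
    inner ℂ (diagonalOperator b g x) y =
      ∑ a, (g a : ℂ) * (inner ℂ x (b a) * inner ℂ (b a) y) := by
  simp only [diagonalOperator_apply, sum_inner, inner_smul_left, Complex.conj_ofReal,
    inner_conj_symm]

theorem inner_diagonalOperator_right (x y : F) :
    inner ℂ x (diagonalOperator b g y) =
      ∑ a, (g a : ℂ) * (inner ℂ x (b a) * inner ℂ (b a) y) := by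
  simp only [diagonalOperator_apply, inner_sum, inner_smul_right]
  exact Finset.sum_congr rfl fun _ _ => by ring

theorem isSymmetric_diagonalOperator : (diagonalOperator b g).IsSymmetric := fun x y => by
  rw [inner_diagonalOperator_left, inner_diagonalOperator_right]

theorem re_inner_diagonalOperator_self (x : F) :
    (inner ℂ (diagonalOperator b g x) x).re = ∑ a, g a * ‖inner ℂ (b a) x‖ ^ 2 := by
  rw [inner_diagonalOperator_left, Complex.re_sum]
  refine Finset.sum_congr rfl fun a _ => ?_
  rw [inner_mul_symm_eq, ← Complex.ofReal_mul, Complex.ofReal_re]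

theorem trace_diagonalOperator :
    (LinearMap.trace ℂ F (diagonalOperator b g)).re = ∑ a, g a := by
  classical
  have := b.toBasis.finiteDimensional_of_finite
  rw [LinearMap.trace_eq_sum_inner _ b, Complex.re_sum]
  refine Finset.sum_congr rfl fun a _ => ?_
  rw [← isSymmetric_diagonalOperator b g, re_inner_diagonalOperator_self,
    Finset.sum_eq_single a (fun c _ hc => by simp [b.orthonormal.2 hc]) (by simp)]
  simp

end Diagonal

/-! ### Eigenvalue inequalities of Weyl and Lidskii -/

section Operators

variable {F F' : Type*} [NormedAddCommGroup F] [InnerProductSpace ℂ F] [FiniteDimensional ℂ F]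
  [NormedAddCommGroup F'] [InnerProductSpace ℂ F'] [FiniteDimensional ℂ F']

/-- The quadratic form of a symmetric operator in terms of its eigenvalues. -/
theorem re_inner_apply_self_eq_sum_eigenvalues {k : ℕ} (hk : finrank ℂ F = k) {S : F →ₗ[ℂ] F}
    (hS : S.IsSymmetric) (x : F) :
    (inner ℂ (S x) x).re =
      ∑ j, hS.eigenvalues hk j * ‖inner ℂ (hS.eigenvectorBasis hk j) x‖ ^ 2 := by
  rw [← (hS.eigenvectorBasis hk).sum_inner_mul_inner, Complex.re_sum]
  refine Finset.sum_congr rfl fun j _ => ?_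
  rw [hS, hS.apply_eigenvectorBasis, inner_smul_right, mul_assoc, inner_mul_symm_eq]
  exact Complex.re_ofReal_mul _ _

/-- **Weyl's monotonicity principle**. -/
theorem eigenvalues_le_add_of_re_inner_le {k : ℕ} (hk : finrank ℂ F = k)
    (hk' : finrank ℂ F' = k) {S : F →ₗ[ℂ] F} {T : F' →ₗ[ℂ] F'} (hS : S.IsSymmetric)
    (hT : T.IsSymmetric) (U : F →ₗᵢ[ℂ] F') {t : ℝ}
    (h : ∀ x, (inner ℂ (S x) x).re ≤ (inner ℂ (T (U x)) (U x)).re + t * ‖x‖ ^ 2) (i : Fin k) :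
    hS.eigenvalues hk i ≤ hT.eigenvalues hk' i + t := by
  -- These are `k - 1` linear conditions in dimension `k`: a nonzero solution sees only the
  -- eigenvalues of `S` from `i` upwards in size and those of `T` from `i` downwards.
  let f : F →ₗ[ℂ] ({j : Fin k // j ≠ i} → ℂ) := LinearMap.pi fun j =>
    if j.1 < i then (innerₛₗ ℂ (hT.eigenvectorBasis hk' j)) ∘ₗ U.toLinearMap
    else innerₛₗ ℂ (hS.eigenvectorBasis hk j)
  have hf : LinearMap.ker f ≠ ⊥ := by
    apply LinearMap.ker_ne_bot_of_finrank_lt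
    have := i.pos
    simp [hk]
    omega
  obtain ⟨x, hx, hx0⟩ := Submodule.exists_mem_ne_zero_of_ne_bot hf
  have hxT : ∀ j < i, inner ℂ (hT.eigenvectorBasis hk' j) (U x) = 0 := by
    intro j hj
    have := congrFun (LinearMap.mem_ker.mp hx) ⟨j, hj.ne⟩
    simpa [f, hj] using this
  have hxS : ∀ j, i < j → inner ℂ (hS.eigenvectorBasis hk j) x = 0 := by
    intro j hj
    have := congrFun (LinearMap.mem_ker.mp hx) ⟨j, hj.ne'⟩
    simpa [f, hj.not_gt] using this
  have h1 : hS.eigenvalues hk i * ‖x‖ ^ 2 ≤ (inner ℂ (S x) x).re := by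
    rw [re_inner_apply_self_eq_sum_eigenvalues hk hS,
      ← (hS.eigenvectorBasis hk).sum_sq_norm_inner_right, Finset.mul_sum]
    refine Finset.sum_le_sum fun j _ => ?_
    rcases le_or_gt j i with hj | hj
    · exact mul_le_mul_of_nonneg_right (hS.eigenvalues_antitone hk hj) (by positivity)
    · simp [hxS j hj]
  have h2 : (inner ℂ (T (U x)) (U x)).re ≤ hT.eigenvalues hk' i * ‖x‖ ^ 2 := by
    rw [re_inner_apply_self_eq_sum_eigenvalues hk' hT, ← U.norm_map,
      ← (hT.eigenvectorBasis hk').sum_sq_norm_inner_right, Finset.mul_sum]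
    refine Finset.sum_le_sum fun j _ => ?_
    rcases le_or_gt i j with hj | hj
    · exact mul_le_mul_of_nonneg_right (hT.eigenvalues_antitone hk' hj) (by positivity)
    · simp [hxT j hj]
  have h3 : 0 < ‖x‖ ^ 2 := by positivity
  have h4 := h x
  exact le_of_mul_le_mul_right (by linarith) h3

/-- **Lidskii's theorem**, in the form of weak majorization by soft thresholding. -/
theorem sum_abs_eigenvalues_sub_sub_max_le {k : ℕ} (hk : finrank ℂ F = k) {S T : F →ₗ[ℂ] F}
    (hS : S.IsSymmetric) (hT : T.IsSymmetric) {t : ℝ} (ht : 0 ≤ t) :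
    ∑ i, max (|hS.eigenvalues hk i - hT.eigenvalues hk i| - t) 0 ≤
      ∑ i, max (|(hS.sub hT).eigenvalues hk i| - t) 0 := by
  set δ := (hS.sub hT).eigenvalues hk
  set u := (hS.sub hT).eigenvectorBasis hk
  -- `G` and `H` are the parts of `S - T` above `t` and below `-t`, so `T - H - t ≤ S ≤ T + G + t`
  -- as forms.
  set G := diagonalOperator u fun a => max (δ a - t) 0 with hG
  set H := diagonalOperator u fun a => max (-δ a - t) 0 with hH
  have hGs : G.IsSymmetric := isSymmetric_diagonalOperator _ _
  have hHs : H.IsSymmetric := isSymmetric_diagonalOperator _ _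
  have hD : ∀ x, (inner ℂ (S x) x).re - (inner ℂ (T x) x).re =
      ∑ a, δ a * ‖inner ℂ (u a) x‖ ^ 2 := fun x => by
    rw [← re_inner_apply_self_eq_sum_eigenvalues hk (hS.sub hT), LinearMap.sub_apply,
      inner_sub_left, Complex.sub_re]
  have hGx : ∀ x, (inner ℂ (G x) x).re = ∑ a, max (δ a - t) 0 * ‖inner ℂ (u a) x‖ ^ 2 :=
    re_inner_diagonalOperator_self _ _
  have hHx : ∀ x, (inner ℂ (H x) x).re = ∑ a, max (-δ a - t) 0 * ‖inner ℂ (u a) x‖ ^ 2 :=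
    re_inner_diagonalOperator_self _ _
  have hN : ∀ x, t * ‖x‖ ^ 2 = ∑ a, t * ‖inner ℂ (u a) x‖ ^ 2 := fun x => by
    rw [← u.sum_sq_norm_inner_right, Finset.mul_sum]
  have h1 : ∀ i, hS.eigenvalues hk i ≤ (hT.add hGs).eigenvalues hk i + t := by
    refine eigenvalues_le_add_of_re_inner_le hk hk hS _ .id fun x => ?_
    have : ∑ a, δ a * ‖inner ℂ (u a) x‖ ^ 2 ≤
        ∑ a, max (δ a - t) 0 * ‖inner ℂ (u a) x‖ ^ 2 + ∑ a, t * ‖inner ℂ (u a) x‖ ^ 2 := by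
      rw [← Finset.sum_add_distrib]
      refine Finset.sum_le_sum fun a _ => ?_
      rw [← add_mul]
      gcongr
      linarith [le_max_left (δ a - t) 0]
    rw [← hD, ← hGx, ← hN] at this
    simp only [LinearIsometry.id_apply, LinearMap.add_apply, inner_add_left, Complex.add_re]
    linarith
  have h2 : ∀ i, (hT.sub hHs).eigenvalues hk i ≤ hS.eigenvalues hk i + t := by
    refine eigenvalues_le_add_of_re_inner_le hk hk _ hS .id fun x => ?_
    have : ∑ a, -(δ a * ‖inner ℂ (u a) x‖ ^ 2) ≤
        ∑ a, max (-δ a - t) 0 * ‖inner ℂ (u a) x‖ ^ 2 + ∑ a, t * ‖inner ℂ (u a) x‖ ^ 2 := by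
      rw [← Finset.sum_add_distrib]
      refine Finset.sum_le_sum fun a _ => ?_
      rw [← add_mul, ← neg_mul]
      gcongr
      linarith [le_max_left (-δ a - t) 0]
    rw [Finset.sum_neg_distrib, ← hD, ← hHx, ← hN] at this
    simp only [LinearIsometry.id_apply, LinearMap.sub_apply, inner_sub_left, Complex.sub_re]
    linarith
  have h3 : ∀ i, hT.eigenvalues hk i ≤ (hT.add hGs).eigenvalues hk i := fun i => by
    have := eigenvalues_le_add_of_re_inner_le hk hk hT (hT.add hGs) .id (t := 0) (fun x => ?_) i
    · simpa using this
    · have : 0 ≤ (inner ℂ (G x) x).re := by rw [hGx]; positivity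
      simp only [LinearIsometry.id_apply, LinearMap.add_apply, inner_add_left, Complex.add_re]
      linarith
  have h4 : ∀ i, (hT.sub hHs).eigenvalues hk i ≤ hT.eigenvalues hk i := fun i => by
    have := eigenvalues_le_add_of_re_inner_le hk hk (hT.sub hHs) hT .id (t := 0) (fun x => ?_) i
    · simpa using this
    · have : 0 ≤ (inner ℂ (H x) x).re := by rw [hHx]; positivity
      simp only [LinearIsometry.id_apply, LinearMap.sub_apply, inner_sub_left, Complex.sub_re]
      linarith
  have tG : ∑ i, (hT.add hGs).eigenvalues hk i =
      ∑ i, hT.eigenvalues hk i + ∑ a, max (δ a - t) 0 := by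
    rw [← LinearMap.IsSymmetric.re_trace_eq_sum_eigenvalues,
      ← LinearMap.IsSymmetric.re_trace_eq_sum_eigenvalues, map_add, map_add]
    congr 1
    exact trace_diagonalOperator _ _
  have tH : ∑ i, (hT.sub hHs).eigenvalues hk i =
      ∑ i, hT.eigenvalues hk i - ∑ a, max (-δ a - t) 0 := by
    rw [← LinearMap.IsSymmetric.re_trace_eq_sum_eigenvalues,
      ← LinearMap.IsSymmetric.re_trace_eq_sum_eigenvalues, map_sub, map_sub]
    congr 1
    exact trace_diagonalOperator _ _
  -- Both brackets are nonnegative, and one of them dominates the thresholded difference; their sums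
  -- are the traces of `G` and `H`.
  calc ∑ i, max (|hS.eigenvalues hk i - hT.eigenvalues hk i| - t) 0
      ≤ ∑ i, (((hT.add hGs).eigenvalues hk i - hT.eigenvalues hk i) +
          (hT.eigenvalues hk i - (hT.sub hHs).eigenvalues hk i)) := by
        refine Finset.sum_le_sum fun i _ => ?_
        have := h1 i
        have := h2 i
        have := h3 i
        have := h4 i
        refine max_le ?_ (by linarith)
        rcases abs_cases (hS.eigenvalues hk i - hT.eigenvalues hk i) with h | h <;> linarith
    _ = ∑ a, (max (δ a - t) 0 + max (-δ a - t) 0) := by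
        rw [Finset.sum_add_distrib, Finset.sum_sub_distrib, Finset.sum_sub_distrib, tG, tH,
          Finset.sum_add_distrib]
        ring
    _ ≤ ∑ i, max (|δ i| - t) 0 := by
        refine Finset.sum_le_sum fun a _ => ?_
        rcases abs_cases (δ a) with h | h <;> rw [h.1]
        · rw [max_eq_right (a := -δ a - t) (by linarith)]; linarith
        · rw [max_eq_right (a := δ a - t) (by linarith)]; linarith

/-- The eigenvalues are invariant under unitary equivalence. -/
theorem eigenvalues_eq_of_re_inner_eq {k : ℕ} (hk : finrank ℂ F = k)
    (hk' : finrank ℂ F' = k) {S : F →ₗ[ℂ] F} {T : F' →ₗ[ℂ] F'} (hS : S.IsSymmetric)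
    (hT : T.IsSymmetric) (U : F ≃ₗᵢ[ℂ] F')
    (h : ∀ x, (inner ℂ (S x) x).re = (inner ℂ (T (U x)) (U x)).re) :
    hS.eigenvalues hk = hT.eigenvalues hk' := by
  ext i
  apply le_antisymm
  · simpa using eigenvalues_le_add_of_re_inner_le hk hk' hS hT U.toLinearIsometry (t := 0)
      (fun x => by simp [h]) i
  · simpa using eigenvalues_le_add_of_re_inner_le hk' hk hT hS U.symm.toLinearIsometry (t := 0)
      (fun x => by simp [h]) i

end Operators

/-! ### Norm and form estimates for diagonal operators -/

section DiagonalNorm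

variable {F ι : Type*} [NormedAddCommGroup F] [InnerProductSpace ℂ F] [Fintype ι]
  (b : OrthonormalBasis ι ℂ F) (g : ι → ℝ)

theorem inner_basis_diagonalOperator (i : ι) (x : F) :
    inner ℂ (b i) (diagonalOperator b g x) = (g i : ℂ) * inner ℂ (b i) x := by
  classical
  rw [inner_diagonalOperator_right, Finset.sum_eq_single i
    (fun c _ hc => by simp [b.orthonormal.2 hc.symm]) (by simp)]
  simp

theorem norm_sq_diagonalOperator (x : F) :
    ‖diagonalOperator b g x‖ ^ 2 = ∑ i, g i ^ 2 * ‖inner ℂ (b i) x‖ ^ 2 := by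
  rw [← b.sum_sq_norm_inner_right]
  refine Finset.sum_congr rfl fun i _ => ?_
  rw [inner_basis_diagonalOperator, norm_mul, mul_pow, Complex.norm_real, Real.norm_eq_abs, sq_abs]

theorem sub_diagonalOperator (x : F) :
    x - diagonalOperator b g x = diagonalOperator b (fun i => 1 - g i) x := by
  refine b.repr.injective (PiLp.ext fun i => ?_)
  simp only [b.repr_apply_apply, inner_sub_right, inner_basis_diagonalOperator]
  push_cast; ring

theorem abs_re_inner_diagonalOperator_le (hg : ∀ i, 0 ≤ g i) (x y : F) :
    2 * |(inner ℂ (diagonalOperator b g x) y).re| ≤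
      ∑ i, g i * (‖inner ℂ (b i) x‖ ^ 2 + ‖inner ℂ (b i) y‖ ^ 2) := by
  have h : |(inner ℂ (diagonalOperator b g x) y).re| ≤
      ∑ i, g i * (‖inner ℂ (b i) x‖ * ‖inner ℂ (b i) y‖) := by
    refine (Complex.abs_re_le_norm _).trans ?_
    rw [inner_diagonalOperator_left]
    refine (norm_sum_le _ _).trans (Finset.sum_le_sum fun i _ => ?_)
    rw [norm_mul, norm_mul, Complex.norm_real, Real.norm_of_nonneg (hg i), norm_inner_symm]
  refine (mul_le_mul_of_nonneg_left h zero_le_two).trans ?_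
  rw [Finset.mul_sum]
  refine Finset.sum_le_sum fun i _ => ?_
  rw [mul_left_comm]
  refine mul_le_mul_of_nonneg_left ?_ (hg i)
  linarith [two_mul_le_add_sq ‖(inner ℂ (b i) x : ℂ)‖ ‖(inner ℂ (b i) y : ℂ)‖]

end DiagonalNorm

/-! ### Comparing compressions to two subspaces -/

section Compressions

variable {E F : Type*} [NormedAddCommGroup E] [InnerProductSpace ℂ E]
  [NormedAddCommGroup F] [InnerProductSpace ℂ F]

/-- A contraction has a quadratic form bounded by the square of the norm. -/
theorem abs_re_inner_apply_self_le {K : E →ₗ[ℂ] E} (hK : ∀ y, ‖K y‖ ≤ ‖y‖) (y : E) :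
    |(inner ℂ (K y) y).re| ≤ ‖y‖ ^ 2 :=
  (Complex.abs_re_le_norm _).trans <| (norm_inner_le_norm _ _).trans <| by
    rw [sq]; exact mul_le_mul_of_nonneg_right (hK y) (norm_nonneg y)

/-- Comparison of the quadratic forms of two compressions of a symmetric contraction `K`, the first
one to an invariant subspace, in terms of the cosines `σ` of the principal angles. -/
theorem abs_re_inner_compression_sub_le {ι : Type*} [Fintype ι] {X Y : F →ₗᵢ[ℂ] E}
    {K : E →ₗ[ℂ] E} (hKs : K.IsSymmetric) (hK : ∀ y, ‖K y‖ ≤ ‖y‖) {L : F →ₗ[ℂ] F}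
    (hL : ∀ x, K (X x) = X (L x)) (v : OrthonormalBasis ι ℂ F) {σ : ι → ℝ}
    (hσ : ∀ i, σ i ≤ 1) (hXY : ∀ i x, inner ℂ (X x) (Y (v i)) = σ i * inner ℂ x (v i)) (u : F) :
    |(inner ℂ (K (X u)) (X u)).re - (inner ℂ (K (Y u)) (Y u)).re| ≤
      ∑ i, (1 - σ i) * (3 * ‖inner ℂ (v i) u‖ ^ 2 + ‖inner ℂ (v i) (L u)‖ ^ 2) := by
  set C := diagonalOperator v σ
  have hC : ∀ x, inner ℂ (X x) (Y u) = inner ℂ x (C u) := fun x => by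
    conv_lhs => rw [← v.sum_repr' u]
    simp only [map_sum, map_smul, inner_sum, inner_smul_right, hXY]
    rw [inner_diagonalOperator_right]
    exact Finset.sum_congr rfl fun _ _ => by ring
  obtain ⟨z, hz⟩ : ∃ z, Y u = X (C u) + z := ⟨Y u - X (C u), by abel⟩
  have hXz : ∀ x, inner ℂ (X x) z = 0 := fun x => by
    have := hC x
    rw [hz, inner_add_right, X.inner_map_map] at this
    simpa using this
  have hzX : ∀ x, inner ℂ z (X x) = 0 := fun x => inner_eq_zero_symm.mp (hXz x)
  have hLs : L.IsSymmetric := fun x y => by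
    rw [← X.inner_map_map, ← X.inner_map_map, ← hL, ← hL, hKs]
  have hLn : ∀ x, ‖L x‖ ≤ ‖x‖ := fun x => by
    rw [← X.norm_map (L x), ← X.norm_map x, ← hL]; exact hK _
  have hzn : ‖z‖ ^ 2 = ‖u‖ ^ 2 - ‖C u‖ ^ 2 := by
    have := norm_add_sq_eq_norm_sq_add_norm_sq_of_inner_eq_zero (X (C u)) z (hXz _)
    rw [← hz, Y.norm_map, X.norm_map] at this
    linarith
  -- The cross terms vanish: `K` is symmetric and maps the range of `X`, which is orthogonal to `z`,
  -- into itself.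
  have hYu : inner ℂ (K (Y u)) (Y u) = inner ℂ (L (C u)) (C u) + inner ℂ (K z) z := by
    rw [hz, map_add, inner_add_left, inner_add_right, inner_add_right, hKs z (X _), hL, hXz, hzX,
      X.inner_map_map]
    ring
  have hXu : inner ℂ (K (X u)) (X u) = inner ℂ (L u) u := by rw [hL, X.inner_map_map]
  set w := diagonalOperator v (fun i => 1 - σ i) u with hw
  have hCw : C u = u - w := by rw [hw, ← sub_diagonalOperator]; abel
  have hLu : (inner ℂ (L u) w).re = (inner ℂ w (L u)).re := by
    rw [← inner_conj_symm, Complex.conj_re]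
  have key : (inner ℂ (K (X u)) (X u)).re - (inner ℂ (K (Y u)) (Y u)).re =
      2 * (inner ℂ w (L u)).re - (inner ℂ (L w) w).re - (inner ℂ (K z) z).re := by
    rw [hXu, hYu, hCw, map_sub, inner_sub_left, inner_sub_right, inner_sub_right, hLs w u]
    simp only [Complex.add_re, Complex.sub_re, hLu]
    ring
  have b1 := abs_re_inner_diagonalOperator_le v _ (fun i => sub_nonneg.mpr (hσ i)) u (L u)
  have b2 := abs_re_inner_apply_self_le hLn w
  have b3 := abs_re_inner_apply_self_le hK z
  rw [hzn, ← v.sum_sq_norm_inner_right u, norm_sq_diagonalOperator] at b3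
  rw [hw, norm_sq_diagonalOperator, ← hw] at b2
  rw [← hw] at b1
  -- The coefficient 3 is 1 from the mixed term plus 2 from `(1 - σ) ^ 2 + (1 - σ ^ 2) = 2 * (1 -
  -- σ)`.
  have htot : ∑ i, (1 - σ i) * (3 * ‖inner ℂ (v i) u‖ ^ 2 + ‖inner ℂ (v i) (L u)‖ ^ 2) =
      ∑ i, (1 - σ i) * (‖inner ℂ (v i) u‖ ^ 2 + ‖inner ℂ (v i) (L u)‖ ^ 2) +
      ∑ i, (1 - σ i) ^ 2 * ‖inner ℂ (v i) u‖ ^ 2 +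
      (∑ i, ‖inner ℂ (v i) u‖ ^ 2 - ∑ i, σ i ^ 2 * ‖inner ℂ (v i) u‖ ^ 2) := by
    rw [← Finset.sum_sub_distrib, ← Finset.sum_add_distrib, ← Finset.sum_add_distrib]
    exact Finset.sum_congr rfl fun _ _ => by ring
  rw [key, htot]
  rw [abs_le] at *
  have := abs_le.mp (le_of_mul_le_mul_left (b1.trans_eq (mul_div_cancel₀ _ two_ne_zero).symm)
    two_pos)
  constructor <;> linarith

/-- Only indices with `δ a > t` contribute. For these, row sums at most 1 and `t ≥ 0` let `t` move
inside the average; column sums at most 1 then bound the total weight of each `β i - t`. -/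
theorem sum_max_sub_le_of_weights {κ ι : Type*} [Fintype κ] [Fintype ι] {δ : κ → ℝ} {β : ι → ℝ}
    {p : κ → ι → ℝ} (hp : ∀ a i, 0 ≤ p a i) (hp1 : ∀ a, ∑ i, p a i ≤ 1)
    (hp2 : ∀ (J : Finset κ) i, ∑ a ∈ J, p a i ≤ 1) (hδ : ∀ a, δ a ≤ ∑ i, β i * p a i)
    {t : ℝ} (ht : 0 ≤ t) : ∑ a, max (δ a - t) 0 ≤ ∑ i, max (β i - t) 0 := by
  classical
  set J := Finset.univ.filter fun a => t < δ a
  have h1 : ∑ a, max (δ a - t) 0 = ∑ a ∈ J, (δ a - t) := by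
    rw [Finset.sum_filter]
    refine Finset.sum_congr rfl fun a _ => ?_
    split_ifs with h
    · exact max_eq_left (by linarith)
    · exact max_eq_right (by linarith)
  calc ∑ a, max (δ a - t) 0 = ∑ a ∈ J, (δ a - t) := h1
    _ ≤ ∑ a ∈ J, ∑ i, (β i - t) * p a i := by
        refine Finset.sum_le_sum fun a _ => ?_
        simp only [sub_mul, Finset.sum_sub_distrib, ← Finset.mul_sum]
        linarith [hδ a, mul_le_mul_of_nonneg_left (hp1 a) ht]
    _ = ∑ i, (β i - t) * ∑ a ∈ J, p a i := by
        rw [Finset.sum_comm]; simp only [Finset.mul_sum]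
    _ ≤ ∑ i, max (β i - t) 0 := by
        refine Finset.sum_le_sum fun i _ => ?_
        have h0 : 0 ≤ ∑ a ∈ J, p a i := Finset.sum_nonneg fun a _ => hp a i
        calc (β i - t) * ∑ a ∈ J, p a i ≤ max (β i - t) 0 * ∑ a ∈ J, p a i :=
              mul_le_mul_of_nonneg_right (le_max_left _ _) h0
          _ ≤ max (β i - t) 0 := mul_le_of_le_one_right (le_max_right _ _) (hp2 J i)

variable [FiniteDimensional ℂ F]

theorem sum_abs_eigenvalues_compression_sub_max_le_of_diagonal {k : ℕ} (hk : finrank ℂ F = k)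
    {X Y : F →ₗᵢ[ℂ] E} {K : E →ₗ[ℂ] E} (hKs : K.IsSymmetric) (hK : ∀ y, ‖K y‖ ≤ ‖y‖)
    {L : F →ₗ[ℂ] F} (hL : ∀ x, K (X x) = X (L x)) (v : OrthonormalBasis (Fin k) ℂ F)
    {σ : Fin k → ℝ} (hσ : ∀ i, σ i ≤ 1)
    (hXY : ∀ i x, inner ℂ (X x) (Y (v i)) = σ i * inner ℂ x (v i)) {m r : ℝ} (hr : 0 ≤ r)
    {S T : F →ₗ[ℂ] F} (hS : S.IsSymmetric) (hT : T.IsSymmetric)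
    (hSX : ∀ x, (inner ℂ (S x) x).re = m * ‖x‖ ^ 2 + r * (inner ℂ (K (X x)) (X x)).re)
    (hTY : ∀ x, (inner ℂ (T x) x).re = m * ‖x‖ ^ 2 + r * (inner ℂ (K (Y x)) (Y x)).re)
    {t : ℝ} (ht : 0 ≤ t) :
    ∑ i, max (|hS.eigenvalues hk i - hT.eigenvalues hk i| - t) 0 ≤
      ∑ i, max (4 * r * (1 - σ i) - t) 0 := by
  refine (sum_abs_eigenvalues_sub_sub_max_le hk hS hT ht).trans ?_
  set u := (hS.sub hT).eigenvectorBasis hk with hu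
  have hLs : L.IsSymmetric := fun x y => by
    rw [← X.inner_map_map, ← X.inner_map_map, ← hL, ← hL, hKs]
  have hLn : ∀ x, ‖L x‖ ≤ ‖x‖ := fun x => by
    rw [← X.norm_map (L x), ← X.norm_map x, ← hL]; exact hK _
  -- Dividing by `4 = 3 + 1` makes the weights doubly substochastic: rows by Parseval and `‖L‖ ≤ 1`,
  -- columns by Bessel after moving the symmetric `L` onto `v i`.
  refine sum_max_sub_le_of_weights (p := fun a i =>
    (3 * ‖inner ℂ (v i) (u a)‖ ^ 2 + ‖inner ℂ (v i) (L (u a))‖ ^ 2) / 4)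
    (fun a i => by positivity) (fun a => ?_) (fun J i => ?_) (fun a => ?_) ht
  · rw [← Finset.sum_div, Finset.sum_add_distrib, ← Finset.mul_sum, v.sum_sq_norm_inner_right,
      v.sum_sq_norm_inner_right]
    have h1 := u.norm_eq_one a
    have h2 := hLn (u a)
    rw [h1] at h2 ⊢
    have := pow_le_one₀ (n := 2) (norm_nonneg (L (u a))) h2
    linarith
  · have h1 : ∑ a ∈ J, ‖inner ℂ (v i) (u a)‖ ^ 2 ≤ 1 := by
      have := u.orthonormal.sum_inner_products_le (s := J) (v i)
      simp_rw [norm_inner_symm (u _) (v i), v.norm_eq_one, one_pow] at this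
      exact this
    have h2 : ∑ a ∈ J, ‖inner ℂ (v i) (L (u a))‖ ^ 2 ≤ 1 := by
      have := u.orthonormal.sum_inner_products_le (s := J) (L (v i))
      simp_rw [norm_inner_symm (u _) (L (v i)), hLs (v i)] at this
      refine this.trans (pow_le_one₀ (norm_nonneg _) ((hLn _).trans_eq (v.norm_eq_one i)))
    rw [← Finset.sum_div, Finset.sum_add_distrib, ← Finset.mul_sum]
    linarith
  · have h1 : (hS.sub hT).eigenvalues hk a =
        r * ((inner ℂ (K (X (u a))) (X (u a))).re - (inner ℂ (K (Y (u a))) (Y (u a))).re) := by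
      have h2 : (inner ℂ ((S - T) (u a)) (u a)).re = (hS.sub hT).eigenvalues hk a := by
        rw [hu, (hS.sub hT).apply_eigenvectorBasis, inner_smul_left, inner_self_eq_norm_sq_to_K,
          OrthonormalBasis.norm_eq_one]
        simp
      rw [← h2, LinearMap.sub_apply, inner_sub_left, Complex.sub_re, hSX, hTY]
      ring
    rw [h1, abs_mul, abs_of_nonneg hr]
    refine (mul_le_mul_of_nonneg_left
      (abs_re_inner_compression_sub_le hKs hK hL v hσ hXY (u a)) hr).trans_eq ?_
    rw [Finset.mul_sum]
    exact Finset.sum_congr rfl fun i _ => by ring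

theorem sum_abs_eigenvalues_compression_sub_max_le {k : ℕ} (hk : finrank ℂ F = k)
    {X Y : F →ₗᵢ[ℂ] E} {K : E →ₗ[ℂ] E} (hKs : K.IsSymmetric) (hK : ∀ y, ‖K y‖ ≤ ‖y‖)
    {L : F →ₗ[ℂ] F} (hL : ∀ x, K (X x) = X (L x)) (v w : OrthonormalBasis (Fin k) ℂ F)
    {σ : Fin k → ℝ} (hσ : ∀ i, σ i ≤ 1)
    (hXY : ∀ i x, inner ℂ (X x) (Y (v i)) = σ i * inner ℂ x (w i)) {m r : ℝ} (hr : 0 ≤ r)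
    {S T : F →ₗ[ℂ] F} (hS : S.IsSymmetric) (hT : T.IsSymmetric)
    (hSX : ∀ x, (inner ℂ (S x) x).re = m * ‖x‖ ^ 2 + r * (inner ℂ (K (X x)) (X x)).re)
    (hTY : ∀ x, (inner ℂ (T x) x).re = m * ‖x‖ ^ 2 + r * (inner ℂ (K (Y x)) (Y x)).re)
    {t : ℝ} (ht : 0 ≤ t) :
    ∑ i, max (|hS.eigenvalues hk i - hT.eigenvalues hk i| - t) 0 ≤
      ∑ i, max (4 * r * (1 - σ i) - t) 0 := by
  -- Replacing `X` by `X ∘ U` turns the singular value decomposition into the diagonal case.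
  let U : F ≃ₗᵢ[ℂ] F := v.equiv w (Equiv.refl _)
  have hUv : ∀ i, U (v i) = w i := fun i => by simp [U]
  have hUs : ∀ x y, inner ℂ (U.symm x) y = inner ℂ x (U y) := fun x y => by
    rw [← U.inner_map_map, U.apply_symm_apply]
  let conj (R : F →ₗ[ℂ] F) : F →ₗ[ℂ] F :=
    U.symm.toLinearEquiv.toLinearMap ∘ₗ R ∘ₗ U.toLinearEquiv.toLinearMap
  have hconj : ∀ R x, conj R x = U.symm (R (U x)) := fun _ _ => rfl
  have hS' : (conj S).IsSymmetric := fun x y => by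
    rw [hconj, hconj, hUs, hS, ← U.inner_map_map x, U.apply_symm_apply]
  have hSS : hS'.eigenvalues hk = hS.eigenvalues hk :=
    eigenvalues_eq_of_re_inner_eq hk hk hS' hS U fun x => by rw [hconj, hUs]
  rw [← hSS]
  refine sum_abs_eigenvalues_compression_sub_max_le_of_diagonal hk (X := X.comp U.toLinearIsometry)
    (L := conj L) hKs hK (fun x => ?_) v hσ (fun i x => ?_) (m := m) hr hS' hT (fun x => ?_) hTY ht
  · simp [hconj, hL]
  · simp [hXY, ← hUv]
  · simp [hconj, hUs, hSX]

/-- The singular value decomposition. -/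
theorem exists_singularValueDecomposition {k : ℕ} (hk : finrank ℂ F = k) (C : F →ₗ[ℂ] F) :
    ∃ v w : OrthonormalBasis (Fin k) ℂ F, ∀ i, C (v i) = (C.singularValues i : ℂ) • w i := by
  set v := C.isSymmetric_adjoint_comp_self.eigenvectorBasis hk with hv
  have hC : ∀ i j, inner ℂ (C (v i)) (C (v j)) =
      (C.singularValues j : ℂ) ^ 2 * inner ℂ (v i) (v j) := fun i j => by
    rw [← LinearMap.adjoint_inner_right, ← LinearMap.comp_apply, hv,
      C.isSymmetric_adjoint_comp_self.apply_eigenvectorBasis, inner_smul_right,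
      ← C.sq_singularValues_fin hk]
    push_cast; rfl
  -- Normalized images exist only for nonzero singular values; any orthonormal extension serves for
  -- the rest, where `C (v i) = 0`.
  have ho : Orthonormal ℂ ({i : Fin k | C.singularValues i ≠ 0}.domRestrict fun i =>
      ((C.singularValues i : ℂ))⁻¹ • C (v i)) := by
    rw [orthonormal_iff_ite]
    rintro ⟨i, hi⟩ ⟨j, hj⟩
    have hi' : (C.singularValues i : ℂ) ≠ 0 := by exact_mod_cast hi
    simp only [Set.domRestrict_apply, inner_smul_left, inner_smul_right, hC,
      v.inner_eq_ite, Subtype.mk.injEq]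
    split_ifs with h
    · subst h
      simp only [map_inv₀, Complex.conj_ofReal]
      field_simp
    · simp
  obtain ⟨w, hw⟩ := ho.exists_orthonormalBasis_extension_of_card_eq (by simpa using hk)
  refine ⟨v, w, fun i => ?_⟩
  by_cases h : C.singularValues i = 0
  · have := hC i i
    rw [h] at this ⊢
    simpa using this
  · have h' : (C.singularValues i : ℂ) ≠ 0 := by exact_mod_cast h
    rw [hw i h, smul_inv_smul₀ h']

end Compressions

/-! ### Return to matrices and Ritz values -/

section Matrices

/-- A symmetric operator with spectrum in `[m - r, m + r]` is `m + r K` for a symmetric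
contraction `K`. -/
theorem exists_contraction_of_eigenvalues {E : Type*} [NormedAddCommGroup E]
    [InnerProductSpace ℂ E] [FiniteDimensional ℂ E] {n : ℕ} (hn : finrank ℂ E = n)
    {T : E →ₗ[ℂ] E} (hT : T.IsSymmetric) {m r : ℝ}
    (h : ∀ i, |hT.eigenvalues hn i - m| ≤ r) (hr : 0 ≤ r) :
    ∃ K : E →ₗ[ℂ] E, K.IsSymmetric ∧ (∀ y, ‖K y‖ ≤ ‖y‖) ∧
      (K = (r⁻¹ : ℂ) • (T - (m : ℂ) • LinearMap.id)) ∧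
      ∀ y, T y = (m : ℂ) • y + (r : ℂ) • K y := by
  set e := hT.eigenvectorBasis hn with he
  have hbound : ∀ y, ‖T y - (m : ℂ) • y‖ ≤ r * ‖y‖ := fun y => by
    refine le_of_sq_le_sq ?_ (by positivity)
    rw [mul_pow, ← e.sum_sq_norm_inner_right, ← e.sum_sq_norm_inner_right, Finset.mul_sum]
    refine Finset.sum_le_sum fun i _ => ?_
    rw [inner_sub_right, ← hT, he, hT.apply_eigenvectorBasis, inner_smul_left, inner_smul_right,
      ← he, ← sub_mul, norm_mul, mul_pow]
    refine mul_le_mul_of_nonneg_right (pow_le_pow_left₀ (norm_nonneg _) ?_ 2) (by positivity)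
    have : (starRingEnd ℂ) ((hT.eigenvalues hn i : ℝ) : ℂ) - (m : ℂ) =
        ((hT.eigenvalues hn i - m : ℝ) : ℂ) := by simp
    exact (congrArg norm this).trans_le (by rw [Complex.norm_real]; exact h i)
  -- If `r = 0`, the convention `0⁻¹ = 0` gives `K = 0`, which is right because `T` is then the
  -- scalar `m`.
  refine ⟨(r⁻¹ : ℂ) • (T - (m : ℂ) • LinearMap.id), fun x y => ?_, fun y => ?_, rfl, fun y => ?_⟩
  · simp only [LinearMap.smul_apply, LinearMap.sub_apply, LinearMap.id_apply, inner_smul_left,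
      inner_smul_right, inner_sub_left, inner_sub_right, map_inv₀, Complex.conj_ofReal, hT x y]
  · simp only [LinearMap.smul_apply, LinearMap.sub_apply, LinearMap.id_apply, norm_smul, norm_inv,
      Complex.norm_real, Real.norm_of_nonneg hr]
    rcases hr.eq_or_lt with rfl | hr
    · simp
    · rw [inv_mul_le_iff₀ hr]; exact hbound y
  · simp only [LinearMap.smul_apply, LinearMap.sub_apply, LinearMap.id_apply]
    rcases hr.eq_or_lt with rfl | hr
    · have := hbound y
      rw [zero_mul, norm_le_zero_iff, sub_eq_zero] at this
      simp [this]
    · rw [smul_inv_smul₀ (by exact_mod_cast hr.ne')]; abel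

theorem eigenvalues_cast {E : Type*} [NormedAddCommGroup E]
    [InnerProductSpace ℂ E] [FiniteDimensional ℂ E] {n n' : ℕ} (hn : finrank ℂ E = n)
    (hn' : finrank ℂ E = n') (h : n' = n) {T : E →ₗ[ℂ] E} (hT : T.IsSymmetric) (i : Fin n') :
    hT.eigenvalues hn (Fin.cast h i) = hT.eigenvalues hn' i := by
  subst h; rfl

theorem eigenvaluesDesc_eq {n : ℕ} {A : Matrix (Fin n) (Fin n) ℂ} (hA : A.IsHermitian)
    (i : Fin n) : eigenvaluesDesc hA i =
      (Matrix.isSymmetric_toEuclideanLin_iff.mpr hA).eigenvalues finrank_euclideanSpace_fin i :=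
  eigenvalues_cast _ _ _ _ _

theorem abs_eigenvaluesDesc_sub_le_spread {n : ℕ} {A : Matrix (Fin n) (Fin n) ℂ}
    (hA : A.IsHermitian) : ∃ m : ℝ, ∀ i, |eigenvaluesDesc hA i - m| ≤ spread hA / 2 := by
  rcases Nat.eq_zero_or_pos n with rfl | hn
  · exact ⟨0, fun i => i.elim0⟩
  · refine ⟨(eigenvaluesDesc hA ⟨0, hn⟩ +
      eigenvaluesDesc hA ⟨n - 1, Nat.sub_lt hn one_pos⟩) / 2, fun i => ?_⟩
    have h1 := eigenvaluesDesc_antitone hA (Fin.mk_le_mk.mpr (Nat.zero_le i) : ⟨0, hn⟩ ≤ i)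
    have h2 := eigenvaluesDesc_antitone hA
      (Fin.mk_le_mk.mpr (Nat.le_sub_one_of_lt i.2) : i ≤ ⟨n - 1, Nat.sub_lt hn one_pos⟩)
    rw [spread, dif_pos hn, abs_le]
    constructor <;> linarith

variable {n k : ℕ}

theorem inner_toEuclideanLin_left {m : ℕ} (M : Matrix (Fin m) (Fin n) ℂ)
    (x : EuclideanSpace ℂ (Fin n)) (y : EuclideanSpace ℂ (Fin m)) :
    inner ℂ (M.toEuclideanLin x) y = inner ℂ x (Mᴴ.toEuclideanLin y) := by
  rw [Matrix.toEuclideanLin_conjTranspose_eq_adjoint, LinearMap.adjoint_inner_right]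

theorem toEuclideanLin_mul_apply {l m : ℕ} (M : Matrix (Fin l) (Fin m) ℂ)
    (N : Matrix (Fin m) (Fin n) ℂ) (x : EuclideanSpace ℂ (Fin n)) :
    (M * N).toEuclideanLin x = M.toEuclideanLin (N.toEuclideanLin x) := by
  simp [Matrix.toLpLin_apply]

/-- The isometry given by a matrix with orthonormal columns. -/
noncomputable def isometryOfOrthonormalColumns (X : Matrix (Fin n) (Fin k) ℂ) (hX : Xᴴ * X = 1) :
    EuclideanSpace ℂ (Fin k) →ₗᵢ[ℂ] EuclideanSpace ℂ (Fin n) :=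
  X.toEuclideanLin.isometryOfInner fun x y => by
    rw [inner_toEuclideanLin_left, ← toEuclideanLin_mul_apply, hX]
    simp

theorem isometryOfOrthonormalColumns_apply {X : Matrix (Fin n) (Fin k) ℂ} (hX : Xᴴ * X = 1)
    (x : EuclideanSpace ℂ (Fin k)) :
    isometryOfOrthonormalColumns X hX x = X.toEuclideanLin x := rfl

theorem exists_eq_toEuclideanLin_of_mem_invtSubmodule {A : Matrix (Fin n) (Fin n) ℂ}
    {X : Matrix (Fin n) (Fin k) ℂ}
    (hinv : LinearMap.range X.mulVecLin ∈ Module.End.invtSubmodule A.mulVecLin)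
    (x : EuclideanSpace ℂ (Fin k)) :
    ∃ y, A.toEuclideanLin (X.toEuclideanLin x) = X.toEuclideanLin y := by
  obtain ⟨y, hy⟩ := (Module.End.mem_invtSubmodule_iff_forall_mem_of_mem _).mp hinv
    (X.mulVecLin x.ofLp) ⟨x.ofLp, rfl⟩
  refine ⟨WithLp.toLp 2 y, ?_⟩
  simp only [Matrix.toLpLin_apply]
  exact congrArg _ hy.symm

theorem sum_abs_ritzValues_sub_max_le {A : Matrix (Fin n) (Fin n) ℂ} (hA : A.IsHermitian)
    {X Y : Matrix (Fin n) (Fin k) ℂ} (hX : Xᴴ * X = 1) (hY : Yᴴ * Y = 1)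
    (hinv : LinearMap.range X.mulVecLin ∈ Module.End.invtSubmodule A.mulVecLin)
    (v w : OrthonormalBasis (Fin k) ℂ (EuclideanSpace ℂ (Fin k))) {σ : Fin k → ℝ}
    (hσ : ∀ i, σ i ≤ 1) (hXY : ∀ i x, inner ℂ (isometryOfOrthonormalColumns X hX x)
      (isometryOfOrthonormalColumns Y hY (v i)) = σ i * inner ℂ x (w i)) {t : ℝ} (ht : 0 ≤ t) :
    ∑ i, max (|eigenvaluesDesc (Matrix.isHermitian_conjTranspose_mul_mul X hA) i -
        eigenvaluesDesc (Matrix.isHermitian_conjTranspose_mul_mul Y hA) i| - t) 0 ≤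
      ∑ i, max (spread hA * (2 * (1 - σ i)) - t) 0 := by
  obtain ⟨m, hm⟩ := abs_eigenvaluesDesc_sub_le_spread hA
  have hr : 0 ≤ spread hA / 2 := div_nonneg (spread_nonneg hA) zero_le_two
  simp only [eigenvaluesDesc_eq] at hm ⊢
  obtain ⟨K, hKs, hK, hKe, hAK⟩ := exists_contraction_of_eigenvalues _ _ hm hr
  have hKX : ∀ x, ∃ y, K (X.toEuclideanLin x) = X.toEuclideanLin y := fun x => by
    obtain ⟨y, hy⟩ := exists_eq_toEuclideanLin_of_mem_invtSubmodule hinv x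
    refine ⟨((spread hA / 2 : ℝ)⁻¹ : ℂ) • (y - (m : ℂ) • x), ?_⟩
    rw [hKe, LinearMap.smul_apply, LinearMap.sub_apply, hy]
    simp only [LinearMap.smul_apply, LinearMap.id_apply, map_smul, map_sub]
  -- The projection `X * Xᴴ` fixes the range of `X`, so `L = Xᴴ K X`.
  have hL : ∀ x, K (isometryOfOrthonormalColumns X hX x) =
      isometryOfOrthonormalColumns X hX
        ((Xᴴ.toEuclideanLin ∘ₗ K ∘ₗ X.toEuclideanLin) x) := fun x => by
    obtain ⟨y, hy⟩ := hKX x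
    simp only [isometryOfOrthonormalColumns_apply, LinearMap.comp_apply, hy]
    rw [← toEuclideanLin_mul_apply Xᴴ X, hX]
    simp [Matrix.toLpLin_apply]
  have hquad : ∀ (Z : Matrix (Fin n) (Fin k) ℂ) (hZ : Zᴴ * Z = 1) x,
      (inner ℂ ((Zᴴ * A * Z).toEuclideanLin x) x).re = m * ‖x‖ ^ 2 + spread hA / 2 *
        (inner ℂ (K (isometryOfOrthonormalColumns Z hZ x))
          (isometryOfOrthonormalColumns Z hZ x)).re := fun Z hZ x => by
    rw [toEuclideanLin_mul_apply, toEuclideanLin_mul_apply, inner_toEuclideanLin_left,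
      Matrix.conjTranspose_conjTranspose, hAK, inner_add_left, inner_smul_left, inner_smul_left,
      ← isometryOfOrthonormalColumns_apply hZ, Complex.add_re, Complex.conj_ofReal,
      Complex.conj_ofReal, Complex.re_ofReal_mul, Complex.re_ofReal_mul, LinearIsometry.inner_map_map,
      inner_self_eq_norm_sq_to_K]
    norm_cast
  refine (sum_abs_eigenvalues_compression_sub_max_le _ hKs hK hL v w hσ hXY hr
    _ _ (hquad X hX) (hquad Y hY) ht).trans_eq ?_
  exact Finset.sum_congr rfl fun i _ => by ring_nf

/-! ### From soft thresholds to weak majorization by `tan²` -/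

theorem sum_descending_le {d β : Fin k → ℝ} (hβ : Antitone β) (hβ0 : ∀ i, 0 ≤ β i)
    (h : ∀ t, 0 ≤ t → ∑ i, max (d i - t) 0 ≤ ∑ i, max (β i - t) 0) (s : Finset (Fin k))
    (j : Fin k) (hs : s.card = (Finset.Iic j).card) :
    ∑ i ∈ s, d i ≤ ∑ i ∈ Finset.Iic j, β i := by
  have h1 : ∑ i ∈ s, (d i - β j) ≤ ∑ i, max (d i - β j) 0 :=
    (Finset.sum_le_sum fun i _ => le_max_left _ 0).trans
      (Finset.sum_le_univ_sum_of_nonneg fun i => le_max_right _ _)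
  have h2 : ∑ i, max (β i - β j) 0 = ∑ i ∈ Finset.Iic j, (β i - β j) := by
    symm
    rw [← Finset.sum_subset (Finset.subset_univ (Finset.Iic j)) fun i _ hi => ?_]
    · exact Finset.sum_congr rfl fun i hi =>
        (max_eq_left (sub_nonneg.mpr (hβ (Finset.mem_Iic.mp hi)))).symm
    · rw [Finset.mem_Iic, not_le] at hi
      exact max_eq_right (sub_nonpos.mpr (hβ hi.le))
  have h3 := h1.trans ((h (β j) (hβ0 j)).trans_eq h2)
  rw [Finset.sum_sub_distrib, Finset.sum_sub_distrib, Finset.sum_const, Finset.sum_const, hs] at h3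
  linarith

/-- Used for the majorant only, since the angles are already in descending order. -/
theorem descending_eq_self {α : Type*} [LinearOrder α] {x : Fin k → α} (hx : Antitone x) :
    descending x = x := by
  have h := (Tuple.comp_sort_eq_comp_iff_monotone (f := x) (σ := Fin.revPerm)).mpr
    (hx.comp fun _ _ h => Fin.rev_le_rev.mpr h)
  ext i
  have := congrFun h (Fin.rev i)
  simpa [descending] using this.symm

theorem tanSq_le_tanSq {a b : ℝ} (ha : 0 ≤ a) (hb : b ≤ Real.pi / 2) (h : a ≤ b) :
    tanSq a ≤ tanSq b := by
  refine ENNReal.div_le_div (ENNReal.ofReal_le_ofReal ?_) (ENNReal.ofReal_le_ofReal ?_)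
  · exact pow_le_pow_left₀ (Real.sin_nonneg_of_nonneg_of_le_pi ha (by linarith))
      (Real.sin_le_sin_of_le_of_le_pi_div_two (by linarith) hb h) 2
  · exact pow_le_pow_left₀ (Real.cos_nonneg_of_neg_pi_div_two_le_of_le (by linarith) hb)
      (Real.cos_le_cos_of_nonneg_of_le_pi ha (by linarith) h) 2

theorem two_mul_one_sub_cos_le_tanSq {θ : ℝ} (h : 0 ≤ Real.cos θ) :
    ENNReal.ofReal (2 * (1 - Real.cos θ)) ≤ tanSq θ := by
  rcases h.eq_or_lt with h | h
  · have : Real.sin θ ^ 2 = 1 := by nlinarith [Real.sin_sq_add_cos_sq θ]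
    simp [tanSq, ← h, this]
  · rw [tanSq, ← ENNReal.ofReal_div_of_pos (by positivity)]
    refine ENNReal.ofReal_le_ofReal ?_
    have h1 := Real.cos_le_one θ
    rw [le_div_iff₀ (by positivity), Real.sin_sq]
    -- With `c = cos θ`, this product equals `1 - c ^ 2 - 2 * (1 - c) * c ^ 2`.
    have h2 : 0 ≤ (1 - Real.cos θ) * ((1 - Real.cos θ) * (1 + 2 * Real.cos θ)) := by
      have := sub_nonneg.mpr h1
      positivity
    nlinarith

theorem weaklySubmajorizedBy_tanSq {d σ : Fin k → ℝ} {r : ℝ} (hr : 0 ≤ r) (hd : ∀ i, 0 ≤ d i)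
    (hσ : Antitone σ) (hσ0 : ∀ i, 0 ≤ σ i) (hσ1 : ∀ i, σ i ≤ 1)
    (h : ∀ t, 0 ≤ t → ∑ i, max (d i - t) 0 ≤ ∑ i, max (r * (2 * (1 - σ i)) - t) 0) :
    WeaklySubmajorizedBy (fun i => ENNReal.ofReal (d i))
      (fun i => ENNReal.ofReal r * tanSq (Real.arccos (σ (Fin.rev i)))) := by
  intro j
  have hcos : ∀ i, Real.cos (Real.arccos (σ i)) = σ i := fun i =>
    Real.cos_arccos (by linarith [hσ0 i]) (hσ1 i)
  rw [descending_eq_self (x := fun i => ENNReal.ofReal r * tanSq _)]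
  swap
  · intro i i' hii
    refine mul_le_mul_right (tanSq_le_tanSq (Real.arccos_nonneg _)
      (Real.arccos_le_pi_div_two.mpr (hσ0 _)) ?_) _
    exact Real.arccos_le_arccos (hσ (Fin.rev_le_rev.mpr hii))
  set β : Fin k → ℝ := fun i => r * (2 * (1 - σ (Fin.rev i))) with hβ
  have hβ0 : ∀ i, 0 ≤ β i := fun i =>
    mul_nonneg hr (mul_nonneg zero_le_two (sub_nonneg.mpr (hσ1 _)))
  have hβa : Antitone β := fun i i' hii => by
    have := hσ (Fin.rev_le_rev.mpr hii)
    exact mul_le_mul_of_nonneg_left (by linarith) hr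
  -- `π` maps `Finset.Iic j` onto positions of the `j + 1` largest entries of `d`.
  let π : Fin k ↪ Fin k :=
    (Fin.revPerm.trans (Tuple.sort fun i => ENNReal.ofReal (d i))).toEmbedding
  have h' : ∀ t, 0 ≤ t → ∑ i, max (d i - t) 0 ≤ ∑ i, max (β i - t) 0 := fun t ht =>
    (h t ht).trans_eq (Equiv.sum_comp Fin.revPerm fun i => max (r * (2 * (1 - σ i)) - t) 0).symm
  calc ∑ i ∈ Finset.Iic j, descending (fun i => ENNReal.ofReal (d i)) i
      = ∑ i ∈ (Finset.Iic j).map π, ENNReal.ofReal (d i) := by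
        rw [Finset.sum_map]; rfl
    _ = ENNReal.ofReal (∑ i ∈ (Finset.Iic j).map π, d i) :=
        (ENNReal.ofReal_sum_of_nonneg fun i _ => hd i).symm
    _ ≤ ENNReal.ofReal (∑ i ∈ Finset.Iic j, β i) :=
        ENNReal.ofReal_le_ofReal (sum_descending_le hβa hβ0 h' _ j (Finset.card_map _))
    _ = ∑ i ∈ Finset.Iic j, ENNReal.ofReal (β i) :=
        ENNReal.ofReal_sum_of_nonneg fun i _ => hβ0 i
    _ ≤ _ := by
        refine Finset.sum_le_sum fun i _ => ?_
        rw [hβ, ENNReal.ofReal_mul hr]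
        refine mul_le_mul_right ?_ _
        have := two_mul_one_sub_cos_le_tanSq (θ := Real.arccos (σ (Fin.rev i)))
          ((hσ0 _).trans_eq (hcos _).symm)
        rwa [hcos] at this

end Matrices

end RitzMajorization

open RitzMajorization in
theorem corollary3p5 {n k : ℕ} (A : Matrix (Fin n) (Fin n) ℂ) (hA : A.IsHermitian)
    (X Y : Matrix (Fin n) (Fin k) ℂ) (hX : Xᴴ * X = 1) (hY : Yᴴ * Y = 1)
    (hinv : LinearMap.range X.mulVecLin ∈ Module.End.invtSubmodule A.mulVecLin ∨
      LinearMap.range Y.mulVecLin ∈ Module.End.invtSubmodule A.mulVecLin) :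
    RitzMajorization.WeaklySubmajorizedBy
      (fun i : Fin k => ENNReal.ofReal
        |RitzMajorization.eigenvaluesDesc (Matrix.isHermitian_conjTranspose_mul_mul X hA) i -
          RitzMajorization.eigenvaluesDesc (Matrix.isHermitian_conjTranspose_mul_mul Y hA) i|)
      (fun i : Fin k => ENNReal.ofReal (RitzMajorization.spread hA) *
        RitzMajorization.tanSq (RitzMajorization.principalAngles X Y i)) := by
  obtain ⟨v, w, hvw⟩ := exists_singularValueDecomposition finrank_euclideanSpace_fin
    (Xᴴ * Y).toEuclideanLin
  set σ := singularValuesDesc (Xᴴ * Y) with hσ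
  have hXY : ∀ i x, inner ℂ (isometryOfOrthonormalColumns X hX x)
      (isometryOfOrthonormalColumns Y hY (v i)) = σ i * inner ℂ x (w i) := fun i x => by
    rw [isometryOfOrthonormalColumns_apply, isometryOfOrthonormalColumns_apply,
      inner_toEuclideanLin_left, ← toEuclideanLin_mul_apply, hvw, inner_smul_right]
    rfl
  have hσ0 : ∀ i, 0 ≤ σ i := fun i => LinearMap.singularValues_nonneg _ _
  have hσ1 : ∀ i, σ i ≤ 1 := fun i => by
    have h := norm_inner_le_norm (𝕜 := ℂ) (isometryOfOrthonormalColumns X hX (w i))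
      (isometryOfOrthonormalColumns Y hY (v i))
    rw [hXY] at h
    simpa [abs_of_nonneg (hσ0 i)] using h
  refine weaklySubmajorizedBy_tanSq (spread_nonneg hA) (fun i => abs_nonneg _)
    (fun i i' h => LinearMap.singularValues_antitone _ h) hσ0 hσ1 fun t ht => ?_
  rcases hinv with hinv | hinv
  · exact sum_abs_ritzValues_sub_max_le hA hX hY hinv v w hσ1 hXY ht
  -- Here `Y` takes the role of `X`: the adjoint `Yᴴ * X` has the same singular values, with `v` and
  -- `w` exchanged.
  · simp_rw [abs_sub_comm (eigenvaluesDesc (Matrix.isHermitian_conjTranspose_mul_mul X hA) _)]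
    refine sum_abs_ritzValues_sub_max_le hA hY hX hinv w v hσ1 (fun i x => ?_) ht
    rw [← inner_conj_symm, ← inner_conj_symm x, ← Complex.conj_ofReal (σ i), ← map_mul]
    congr 1
    conv_lhs => rw [← v.sum_repr' x]
    simp only [map_sum, map_smul, inner_sum, inner_smul_right, hXY, w.inner_eq_ite]
    simp [mul_comm]
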